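/- Let $d>0$ be a square-free integer, and let $\xi=\sqrt{-d}$ if $-d\equiv 2,3 \pmod 4$ and $\xi=(1+\sqrt{-d})/2$ if $-d\equiv 1\pmod 4$, so that $\mathbb{Z}[\xi]$ is the ring of integers of the imaginary quadratic field $\mathbb{Q}(\sqrt{-d})$. Let $$\Phi=\begin{pmatrix}1&0\\0&\sqrt d\end{pmatrix}\ \text{ if }\xi=\sqrt{-d},\qquad \Phi=\begin{pmatrix}1&\tfrac12\\0&\tfrac{\sqrt d}{2}\end{pmatrix}\ \text{ if }\xi=\tfrac{1+\sqrt{-d}}{2}.$$ For $m\ge 1$ let $\gamma_m$ be Hermite's constant, i.e. the supremum of $\lambda_1(L)^2/\mathrm{Vol}(L)^{2/m}$ over all rank $m$ $\mathbb{Z}$-lattices $L\subset\mathbb{R}^m$, where $\lambda_1(L)$ is the length of a shortest nonzero vector of $L$ and $\mathrm{Vol}(L)$ is the covolume of $L$. Let $n\ge 1$, let $\mathbf{B}=[\mathbf{b}_1,\dots,\mathbf{b}_n]\in\mathbb{C}^{n\times n}$ have linearly independent columns over $\mathbb{C}$, and let $\Lambda=\mathbb{Z}[\xi]\mathbf{b}_1+\cdots+\mathbb{Z}[\xi]\mathbf{b}_n\subset\mathbb{C}^n$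 be the $\mathbb{Z}[\xi]$-lattice with basis $\mathbf{B}$. For $1\le j\le n$ let $\lambda_{j,\mathbb{Z}[\xi]}$ be the $j$th successive minimum of $\Lambda$, i.e. the infimum of the real numbers $r$ such that $\Lambda$ contains $j$ vectors of Euclidean length at most $r$ that are linearly independent over $\mathbb{Z}[\xi]$. Then $$\lambda_{1,\mathbb{Z}[\xi]}^{2}\le\gamma_{2n}\,|\det\Phi|\,|\det\mathbf{B}|^{2/n}$$ and $$\prod_{j=1}^{n}\lambda_{j,\mathbb{Z}[\xi]}^{2}\le\gamma_{2n}^{n}\,|\det\Phi|^{n}\,|\det\mathbf{B}|^{2}.$$ -/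

import Mathlib

noncomputable section

/-- The generator `ξ` of the ring of integers of `ℚ(√-d)` (for squarefree `d > 0`):
`(1 + √-d) / 2` if `-d ≡ 1 (mod 4)`, and `√-d` otherwise, where `√-d = √d * i`. -/
def quadXi (d : ℤ) : ℂ :=
  if -d ≡ 1 [ZMOD 4] then (1 + (√(d : ℝ) : ℂ) * Complex.I) / 2
  else (√(d : ℝ) : ℂ) * Complex.I

/-- The ring `ℤ[ξ]`, as a subring of `ℂ`. -/
def quadRing (d : ℤ) : Subalgebra ℤ ℂ := Algebra.adjoin ℤ {quadXi d}

/-- The generator matrix `Φ` of `ℤ[ξ]` in `ℝ²`: its columns are the coordinates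
(real part, imaginary part) of `1` and `ξ`. -/
def quadPhi (d : ℤ) : Matrix (Fin 2) (Fin 2) ℝ :=
  if -d ≡ 1 [ZMOD 4] then !![1, 1 / 2; 0, √(d : ℝ) / 2]
  else !![1, 0; 0, √(d : ℝ)]

/-- The `j`-th column of `B`, as a vector of the Hermitian space `ℂⁿ`. -/
def basisVec {n : ℕ} (B : Matrix (Fin n) (Fin n) ℂ) (j : Fin n) : EuclideanSpace ℂ (Fin n) :=
  WithLp.toLp 2 (fun i => B i j)

/-- The `ℤ[ξ]`-lattice `ℤ[ξ] b₁ + ⋯ + ℤ[ξ] bₙ` spanned by the columns of `B`. -/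
def quadLattice (d : ℤ) {n : ℕ} (B : Matrix (Fin n) (Fin n) ℂ) :
    Submodule (quadRing d) (EuclideanSpace ℂ (Fin n)) :=
  Submodule.span (quadRing d) (Set.range (basisVec B))

/-- The `j`-th successive minimum (`j ≥ 1`) of an `R`-lattice `L`: the infimum of the real `r` such
that `L` contains `j` vectors of length at most `r` that are linearly independent over `R`. -/
def successiveMin (R : Type*) [Ring R] {E : Type*} [NormedAddCommGroup E] [Module R E]
    (L : Submodule R E) (j : ℕ) : ℝ :=
  sInf {r : ℝ | ∃ v : Fin j → E, LinearIndependent R v ∧ ∀ i, v i ∈ L ∧ ‖v i‖ ≤ r}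

/-- Hermite's constant `γ_m`: the supremum of `λ₁(L)² / Vol(L)^(2/m)` over all
`ℤ`-lattices `L` of rank `m` in the Euclidean space `ℝᵐ`. -/
def hermiteConstant (m : ℕ) : ℝ :=
  sSup {x : ℝ | ∃ (L : Submodule ℤ (EuclideanSpace ℝ (Fin m))) (_ : DiscreteTopology L)
    (_ : IsZLattice ℝ L),
    x = successiveMin ℤ L 1 ^ 2 / ZLattice.covolume L MeasureTheory.volume ^ (2 / (m : ℝ))}

end

open MeasureTheory Module

/-! Under the isometry ℂⁿ ≃ ℝ²ⁿ, Λ contains the ℤ-lattice generated by the vectors bⱼ and ξbⱼ, of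
covolume |Im ξ|ⁿ |det B|² (`covolume_span_realLatticeBasis`), and Im ξ = det Φ. Hermite's constant
in dimension 2n, with exponent 2/(2n) = 1/n on the covolume, gives the first inequality.

The product bound follows by Minkowski's deformation. Take an orthonormal basis e whose k-th vector
is orthogonal to every lattice vector shorter than λₖ, and let T divide the k-th coordinate by λₖ.
If k is the last nonzero coordinate of x ∈ Λ, then ‖x‖ ≥ λₖ, while no coordinate is divided by more
than λₖ, so ‖Tx‖ ≥ 1 (`one_le_norm_toLin_diagonal`). Thus TΛ has first minimum at least 1 and
determinant det B / ∏ λₖ up to modulus; the n-th power of the first inequality for TΛ is the claim.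
-/

theorem successiveMin_nonneg {R E : Type*} [Ring R] [NormedAddCommGroup E] [Module R E]
    (L : Submodule R E) {j : ℕ} (hj : 0 < j) : 0 ≤ successiveMin R L j := by
  refine Real.sInf_nonneg ?_
  rintro r ⟨v, -, hv⟩
  exact (norm_nonneg _).trans (hv ⟨0, hj⟩).2

theorem successiveMin_le {R E : Type*} [Ring R] [NormedAddCommGroup E] [Module R E]
    (L : Submodule R E) {j : ℕ} (hj : 0 < j) {r : ℝ} (v : Fin j → E)
    (hv : LinearIndependent R v) (h : ∀ i, v i ∈ L ∧ ‖v i‖ ≤ r) : successiveMin R L j ≤ r := by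
  refine csInf_le ⟨0, ?_⟩ ⟨v, hv, h⟩
  rintro r ⟨v, -, hv⟩
  exact (norm_nonneg _).trans (hv ⟨0, hj⟩).2

theorem successiveMin_one_le {R E : Type*} [Ring R] [IsDomain R] [NormedAddCommGroup E]
    [Module R E] [IsTorsionFree R E] (L : Submodule R E) {x : E} (hx : x ∈ L) (hx0 : x ≠ 0) :
    successiveMin R L 1 ≤ ‖x‖ :=
  successiveMin_le L one_pos (fun _ => x)
    (linearIndependent_unique_iff.2 hx0) fun _ => ⟨hx, le_rfl⟩

/-- For L = ⊥ the infimum would run over the empty set and be 0 by convention. -/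
theorem le_successiveMin_one {R E : Type*} [Ring R] [IsDomain R] [NormedAddCommGroup E]
    [Module R E] [IsTorsionFree R E] (L : Submodule R E) (hL : L ≠ ⊥) {c : ℝ}
    (h : ∀ x ∈ L, x ≠ 0 → c ≤ ‖x‖) : c ≤ successiveMin R L 1 := by
  obtain ⟨x, hx, hx0⟩ := L.exists_mem_ne_zero_of_ne_bot hL
  refine le_csInf ⟨‖x‖, fun _ => x, linearIndependent_unique_iff.2 hx0, fun _ => ⟨hx, le_rfl⟩⟩ ?_
  rintro r ⟨v, hv, hvL⟩
  exact (h _ (hvL 0).1 (hv.ne_zero 0)).trans (hvL 0).2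

/-! ### Finiteness of Hermite's constant -/

/-- Minkowski's convex body theorem for a ball. A uniform C is needed because the real `sSup` of an
unbounded set is 0, which would make `hermiteConstant` meaningless as an upper bound. -/
theorem successiveMin_sq_le_of_covolume {m : ℕ} (hm : 0 < m) :
    ∃ C : ℝ, ∀ (L : Submodule ℤ (EuclideanSpace ℝ (Fin m))) [DiscreteTopology L]
      [IsZLattice ℝ L],
      successiveMin ℤ L 1 ^ 2 ≤ C * ZLattice.covolume L volume ^ (2 / (m : ℝ)) := by
  have : NeZero m := ⟨hm.ne'⟩
  set V : ℝ := (volume (Metric.ball (0 : EuclideanSpace ℝ (Fin m)) 1)).toReal with hV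
  have hVpos : 0 < V := ENNReal.toReal_pos (Metric.measure_ball_pos _ _ one_pos).ne'
    measure_ball_lt_top.ne
  have hVo : volume (Metric.ball (0 : EuclideanSpace ℝ (Fin m)) 1) = ENNReal.ofReal V :=
    (ENNReal.ofReal_toReal measure_ball_lt_top.ne).symm
  refine ⟨9 / V ^ (2 / (m : ℝ)), fun L _ _ => ?_⟩
  set c := ZLattice.covolume L volume with hc
  have hcpos : 0 < c := ZLattice.covolume_pos L volume
  have hm' : (m : ℝ) ≠ 0 := by exact_mod_cast hm.ne'
  -- The ball of radius r has volume 3ᵐ c. Any factor above 2 gives the strict inequality with 2ᵐ c;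
  -- the choice 3 accounts for the 9 = 3² in C.
  set r : ℝ := 3 * (c / V) ^ (1 / (m : ℝ)) with hr
  have hrpos : 0 < r := by positivity
  have hrm : r ^ m = 3 ^ m * (c / V) := by
    rw [hr, mul_pow, ← Real.rpow_natCast (_ ^ _), ← Real.rpow_mul (by positivity),
      one_div_mul_cancel hm', Real.rpow_one]
  let b := Free.chooseBasis ℤ L
  have fund := ZLattice.isAddFundamentalDomain b volume
  have hF : volume (ZSpan.fundamentalDomain (b.ofZLatticeBasis ℝ)) = ENNReal.ofReal c := by
    rw [hc, ZLattice.covolume_eq_measure_fundamentalDomain L volume fund, measureReal_def,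
      ENNReal.ofReal_toReal
        (Bornology.IsBounded.measure_lt_top (ZSpan.fundamentalDomain_isBounded _)).ne]
  have hlt : volume (ZSpan.fundamentalDomain (b.ofZLatticeBasis ℝ)) *
      2 ^ finrank ℝ (EuclideanSpace ℝ (Fin m)) <
      volume (Metric.ball (0 : EuclideanSpace ℝ (Fin m)) r) := by
    rw [hF, Measure.addHaar_ball_of_pos _ _ hrpos, hVo, finrank_euclideanSpace_fin, hrm,
      ← ENNReal.ofReal_mul (by positivity),
      show (2 : ENNReal) = ENNReal.ofReal 2 by simp, ← ENNReal.ofReal_pow (by norm_num),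
      ← ENNReal.ofReal_mul hcpos.le]
    refine (ENNReal.ofReal_lt_ofReal_iff (by positivity)).2 ?_
    have : (2 : ℝ) ^ m < 3 ^ m := pow_lt_pow_left₀ (by norm_num) (by norm_num) hm.ne'
    rw [mul_assoc, div_mul_cancel₀ _ hVpos.ne', mul_comm]
    exact mul_lt_mul_of_pos_right this hcpos
  have : IsTorsionFree ℤ (EuclideanSpace ℝ (Fin m)) := .trans_faithfulSMul ℤ ℝ _
  have : Countable L.toAddSubgroup := inferInstanceAs (Countable L)
  obtain ⟨x, hx0, hx⟩ := exists_ne_zero_mem_lattice_of_measure_mul_two_pow_lt_measure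
    (L := L.toAddSubgroup) fund (fun x hx => by simpa using hx) (convex_ball _ _) hlt
  have hle : successiveMin ℤ L 1 ≤ r :=
    (successiveMin_one_le L (x := (x : EuclideanSpace ℝ (Fin m))) x.2 (by simpa using hx0)).trans
      (mem_ball_zero_iff.1 hx).le
  calc successiveMin ℤ L 1 ^ 2 ≤ r ^ 2 :=
        pow_le_pow_left₀ (successiveMin_nonneg L one_pos) hle 2
    _ = 9 / V ^ (2 / (m : ℝ)) * c ^ (2 / (m : ℝ)) := by
        rw [hr, mul_pow, ← Real.rpow_natCast (_ ^ _), ← Real.rpow_mul (by positivity),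
          Real.div_rpow hcpos.le hVpos.le]
        push_cast
        rw [one_div_mul_eq_div]
        ring

theorem hermiteConstant_nonneg (m : ℕ) : 0 ≤ hermiteConstant m := by
  refine Real.sSup_nonneg ?_
  rintro x ⟨L, _, _, rfl⟩
  have := ZLattice.covolume_pos L volume
  positivity

theorem successiveMin_sq_le_hermiteConstant {m : ℕ} (hm : 0 < m)
    (L : Submodule ℤ (EuclideanSpace ℝ (Fin m))) [DiscreteTopology L] [IsZLattice ℝ L] :
    successiveMin ℤ L 1 ^ 2 ≤
      hermiteConstant m * ZLattice.covolume L volume ^ (2 / (m : ℝ)) := by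
  obtain ⟨C, hC⟩ := successiveMin_sq_le_of_covolume hm
  have hpos := ZLattice.covolume_pos L volume
  rw [← div_le_iff₀ (by positivity)]
  refine le_csSup ⟨C, ?_⟩ ⟨L, inferInstance, inferInstance, rfl⟩
  rintro x ⟨L, _, _, rfl⟩
  have := ZLattice.covolume_pos L volume
  exact (div_le_iff₀ (by positivity)).2 (hC L)

/-! ### Real coordinates on ℂⁿ -/

/-- Complex coordinates `x + i y` listed as an orthonormal basis of `ℂⁿ` over `ℝ`. -/
noncomputable def realBasisFun (n : ℕ) : Basis (Fin n × Fin 2) ℝ (EuclideanSpace ℂ (Fin n)) :=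
  Complex.basisOneI.smulTower' (EuclideanSpace.basisFun (Fin n) ℂ).toBasis

theorem norm_sq_eq_sum_realBasisFun_repr (n : ℕ) (x : EuclideanSpace ℂ (Fin n)) :
    ‖x‖ ^ 2 = ∑ p, (realBasisFun n).repr x p ^ 2 := by
  rw [EuclideanSpace.norm_sq_eq]
  simp [realBasisFun, Fintype.sum_prod_type, Basis.smulTower'_repr_mk,
    ← Complex.normSq_eq_norm_sq, Complex.normSq_apply, ← sq]

/-- A numbering of the real coordinates of `ℂⁿ`. -/
noncomputable def realIndexEquiv (n : ℕ) : Fin n × Fin 2 ≃ Fin (2 * n) :=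
  finProdFinEquiv.trans (finCongr (mul_comm n 2))

/-- The isometry `ℂⁿ ≃ ℝ²ⁿ` that lists real and imaginary parts. -/
noncomputable def complexIsometry (n : ℕ) :
    EuclideanSpace ℂ (Fin n) ≃ₗᵢ[ℝ] EuclideanSpace ℝ (Fin (2 * n)) where
  toLinearEquiv := ((realBasisFun n).reindex (realIndexEquiv n)).equivFun.trans
    (WithLp.linearEquiv 2 ℝ (Fin (2 * n) → ℝ)).symm
  norm_map' x := by
    rw [← sq_eq_sq₀ (norm_nonneg _) (norm_nonneg _), norm_sq_eq_sum_realBasisFun_repr,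
      EuclideanSpace.norm_sq_eq, ← (realIndexEquiv n).sum_comp]
    simp

theorem complexIsometry_realBasisFun (n : ℕ) (p : Fin n × Fin 2) :
    complexIsometry n (realBasisFun n p) =
      EuclideanSpace.basisFun (Fin (2 * n)) ℝ (realIndexEquiv n p) := by
  ext i
  simp [complexIsometry, Finsupp.single_apply, eq_comm]

/-! ### Covolume of the underlying ℤ-lattice -/

theorem quadPhi_det (d : ℤ) : (quadPhi d).det = (quadXi d).im := by
  unfold quadPhi quadXi
  split_ifs <;> simp [Matrix.det_fin_two]

theorem quadXi_im_pos {d : ℤ} (hd : 0 < d) : 0 < (quadXi d).im := by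
  have : 0 < √(d : ℝ) := Real.sqrt_pos.2 (by exact_mod_cast hd)
  unfold quadXi
  split_ifs <;> simp [this]

theorem linearIndependent_one_of_im_ne_zero {z : ℂ} (hz : z.im ≠ 0) :
    LinearIndependent ℝ ![1, z] := by
  rw [LinearIndependent.pair_iff]
  intro s t h
  have him := congrArg Complex.im h
  have hre := congrArg Complex.re h
  simp [hz] at him hre
  simp_all

/-- The real basis `1, z` of `ℂ`, for `z` not real. -/
noncomputable def basisOneOfImNeZero {z : ℂ} (hz : z.im ≠ 0) : Basis (Fin 2) ℝ ℂ :=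
  basisOfLinearIndependentOfCardEqFinrank (linearIndependent_one_of_im_ne_zero hz)
    (by simp [Complex.finrank_real_complex])

theorem basisOneI_det_basisOneOfImNeZero {z : ℂ} (hz : z.im ≠ 0) :
    (Complex.basisOneI.toMatrix (basisOneOfImNeZero hz)).det = z.im := by
  simp [Matrix.det_fin_two, Basis.toMatrix_apply, basisOneOfImNeZero]

/-- The columns of a matrix with independent columns, as a basis of `ℂⁿ`. -/
noncomputable def columnBasis {n : ℕ} (B : Matrix (Fin n) (Fin n) ℂ) (hB : LinearIndependent ℂ (basisVec B)) :
    Basis (Fin n) ℂ (EuclideanSpace ℂ (Fin n)) :=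
  basisOfLinearIndependentOfCardEqFinrank' _ hB (by simp)

theorem columnBasis_apply {n : ℕ} (B : Matrix (Fin n) (Fin n) ℂ)
    (hB : LinearIndependent ℂ (basisVec B)) (j : Fin n) : columnBasis B hB j = basisVec B j := by
  simp [columnBasis]

theorem toLin_basisFun_apply {n : ℕ} (B : Matrix (Fin n) (Fin n) ℂ) (j : Fin n) :
    Matrix.toLin (EuclideanSpace.basisFun (Fin n) ℂ).toBasis
      (EuclideanSpace.basisFun (Fin n) ℂ).toBasis B
      ((EuclideanSpace.basisFun (Fin n) ℂ).toBasis j) = basisVec B j := by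
  rw [Matrix.toLin_self]
  ext i
  simp [basisVec, Finset.sum_apply, Pi.single_apply]

/-- The basis is the image under B of the standard vectors times 1, z. The latter have the Kronecker
matrix of 1 with a 2 × 2 block of determinant Im z, and a ℂ-linear map has real determinant the norm
|det B|². -/
theorem realBasisFun_det {n : ℕ} {z : ℂ} (hz : z.im ≠ 0) (B : Matrix (Fin n) (Fin n) ℂ)
    (hB : LinearIndependent ℂ (basisVec B)) :
    (realBasisFun n).det ((basisOneOfImNeZero hz).smulTower' (columnBasis B hB)) =
      z.im ^ n * ‖B.det‖ ^ 2 := by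
  set e := (EuclideanSpace.basisFun (Fin n) ℂ).toBasis with he
  set f := Matrix.toLin e e B with hf
  have hcomp : ⇑((basisOneOfImNeZero hz).smulTower' (columnBasis B hB)) =
      ⇑(f.restrictScalars ℝ) ∘ ⇑((basisOneOfImNeZero hz).smulTower' e) := by
    ext1 p
    have h := toLin_basisFun_apply B p.1
    rw [← he, ← hf] at h
    rw [Function.comp_apply, Basis.smulTower'_apply, Basis.smulTower'_apply,
      LinearMap.restrictScalars_apply, LinearMap.map_smul_of_tower, h, columnBasis_apply]
  have hkron : (realBasisFun n).toMatrix ((basisOneOfImNeZero hz).smulTower' e) =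
      Matrix.kroneckerMap (· * ·) (1 : Matrix (Fin n) (Fin n) ℝ)
        (Complex.basisOneI.toMatrix (basisOneOfImNeZero hz)) := by
    ext ⟨i, s⟩ ⟨j, t⟩
    rw [Basis.toMatrix_apply, realBasisFun, Basis.smulTower'_repr_mk, Basis.smulTower'_apply,
      map_smul, Basis.repr_self, Finsupp.smul_apply, smul_eq_mul]
    by_cases h : i = j <;> simp [h, Basis.toMatrix_apply]
  rw [hcomp, Basis.det_comp, LinearMap.det_restrictScalars, hf, LinearMap.det_toLin,
    Basis.det_apply, hkron, Matrix.det_kronecker, basisOneI_det_basisOneOfImNeZero,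
    Algebra.norm_complex_apply, Complex.normSq_eq_norm_sq]
  simp [mul_comm]

/-- The image in `ℝ²ⁿ` of the `ℤ`-span of the vectors `bⱼ`, `z bⱼ`, where `bⱼ` are the columns of
`B`. -/
noncomputable def realLatticeBasis {n : ℕ} {z : ℂ} (hz : z.im ≠ 0) (B : Matrix (Fin n) (Fin n) ℂ)
    (hB : LinearIndependent ℂ (basisVec B)) :
    Basis (Fin n × Fin 2) ℝ (EuclideanSpace ℝ (Fin (2 * n))) :=
  ((basisOneOfImNeZero hz).smulTower' (columnBasis B hB)).map (complexIsometry n).toLinearEquiv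

theorem covolume_span_realLatticeBasis {n : ℕ} {z : ℂ} (hz : z.im ≠ 0)
    (B : Matrix (Fin n) (Fin n) ℂ) (hB : LinearIndependent ℂ (basisVec B)) :
    ZLattice.covolume (Submodule.span ℤ (Set.range (realLatticeBasis hz B hB))) volume =
      |z.im| ^ n * ‖B.det‖ ^ 2 := by
  let b₀ := (EuclideanSpace.basisFun (Fin (2 * n)) ℝ).reindex (realIndexEquiv n).symm
  have hb₀ : b₀.toBasis = (realBasisFun n).map (complexIsometry n).toLinearEquiv := by
    refine Basis.eq_of_apply_eq fun p => ?_
    have := complexIsometry_realBasisFun n p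
    simp [b₀, this]
  have hvol : volume.real (ZSpan.fundamentalDomain b₀.toBasis) = 1 := by
    rw [measureReal_congr (ZSpan.fundamentalDomain_ae_parallelepiped _ volume), measureReal_def]
    simp [b₀.volume_parallelepiped]
  have hdet : b₀.toBasis.det (realLatticeBasis hz B hB) = z.im ^ n * ‖B.det‖ ^ 2 := by
    rw [hb₀, Basis.det_map, realLatticeBasis, ← realBasisFun_det hz B hB]
    congr 1
    ext1 p
    simp
  have hb : ((↑) ∘ (realLatticeBasis hz B hB).restrictScalars ℤ :
      Fin n × Fin 2 → EuclideanSpace ℝ (Fin (2 * n))) = realLatticeBasis hz B hB := by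
    ext1 p
    simp
  rw [ZLattice.covolume_eq_det_mul_measureReal _ volume
    ((realLatticeBasis hz B hB).restrictScalars ℤ) b₀.toBasis, hb, hdet, hvol]
  simp [abs_mul, abs_pow]

/-! ### Orthonormal bases avoiding given subspaces -/

/-- Greedy choice: `W i` and the i vectors already chosen span a proper subspace, so a unit vector
orthogonal to both exists. -/
theorem exists_orthonormal_mem_orthogonal {𝕜 E : Type*} [RCLike 𝕜] [NormedAddCommGroup E]
    [InnerProductSpace 𝕜 E] [FiniteDimensional 𝕜 E] (W : ℕ → Submodule 𝕜 E) (m : ℕ)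
    (hW : ∀ i < m, finrank 𝕜 (W i) + i < finrank 𝕜 E) :
    ∃ e : Fin m → E, Orthonormal 𝕜 e ∧ ∀ i : Fin m, e i ∈ (W i)ᗮ := by
  induction m with
  | zero => exact ⟨Fin.elim0, ⟨fun i => i.elim0, fun i => i.elim0⟩, fun i => i.elim0⟩
  | succ m ih =>
    obtain ⟨e, he, heW⟩ := ih fun i hi => hW i (hi.trans m.lt_succ_self)
    let U := W m ⊔ Submodule.span 𝕜 (Set.range e)
    have hU : finrank 𝕜 U < finrank 𝕜 E := by
      refine lt_of_le_of_lt ((Submodule.finrank_add_le_finrank_add_finrank _ _).trans ?_)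
        (hW m m.lt_succ_self)
      gcongr
      simpa [Set.finrank] using finrank_range_le_card (R := 𝕜) e
    have hU' : Uᗮ ≠ ⊥ := by
      rw [Ne, Submodule.orthogonal_eq_bot_iff]
      intro h
      rw [h, finrank_top] at hU
      exact hU.false
    obtain ⟨x, hx, hx0⟩ := Submodule.exists_mem_ne_zero_of_ne_bot hU'
    let y : E := ((‖x‖⁻¹ : ℝ) : 𝕜) • x
    have hy : y ∈ Uᗮ := Submodule.smul_mem _ _ hx
    have hy1 : ‖y‖ = 1 := by
      simp [y, norm_smul, hx0]
    have hye (i : Fin m) : inner 𝕜 (e i) y = 0 :=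
      Submodule.mem_orthogonal _ _ |>.1 hy _
        (Submodule.mem_sup_right (Submodule.subset_span ⟨i, rfl⟩))
    refine ⟨Fin.snoc (α := fun _ => E) e y, ⟨fun i => ?_, fun i j hij => ?_⟩, fun i => ?_⟩
    · induction i using Fin.lastCases with
      | last => simpa using hy1
      | cast i => simpa using he.1 i
    · induction i using Fin.lastCases with
      | last =>
        induction j using Fin.lastCases with
        | last => exact absurd rfl hij
        | cast j => simpa using inner_eq_zero_symm.1 (hye j)
      | cast i =>
        induction j using Fin.lastCases with
        | last => simpa using hye i
        | cast j => simpa using he.2 (by simpa using hij)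
    · induction i using Fin.lastCases with
      | last => simpa using Submodule.orthogonal_le le_sup_left hy
      | cast i => simpa using heW i

theorem exists_orthonormalBasis_mem_orthogonal {𝕜 E : Type*} [RCLike 𝕜] [NormedAddCommGroup E]
    [InnerProductSpace 𝕜 E] [FiniteDimensional 𝕜 E] {n : ℕ} (hn : finrank 𝕜 E = n)
    (V : ℕ → Submodule 𝕜 E) (hV : ∀ k < n, finrank 𝕜 (V k) ≤ k) :
    ∃ e : OrthonormalBasis (Fin n) 𝕜 E, ∀ k : Fin n, e k ∈ (V k)ᗮ := by
  -- The order is reversed: the subspaces with the largest dimension bound come first, while few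
  -- earlier vectors constrain the choice. The bound is then (n - 1 - i) + i < n.
  obtain ⟨e, he, heW⟩ := exists_orthonormal_mem_orthogonal (fun i => V (n - 1 - i)) n
    fun i hi => by have := hV (n - 1 - i) (by omega); omega
  have he' := he.comp Fin.rev Fin.rev_injective
  refine ⟨OrthonormalBasis.mk he' (ge_of_eq ?_), fun k => ?_⟩
  · exact he'.linearIndependent.span_eq_top_of_card_eq_finrank' (by simp [hn])
  · have h := heW k.rev
    rw [show n - 1 - (k.rev : ℕ) = k by rw [Fin.val_rev]; omega] at h
    simpa using h

/-! ### The first inequality -/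

theorem isTorsionFree_quadRing (d : ℤ) (n : ℕ) :
    IsTorsionFree (quadRing d) (EuclideanSpace ℂ (Fin n)) := .trans_faithfulSMul _ ℂ _

theorem basisVec_mem_quadLattice (d : ℤ) {n : ℕ} (B : Matrix (Fin n) (Fin n) ℂ) (j : Fin n) :
    basisVec B j ∈ quadLattice d B := Submodule.subset_span ⟨j, rfl⟩

theorem quadXi_smul_mem_quadLattice (d : ℤ) {n : ℕ} (B : Matrix (Fin n) (Fin n) ℂ)
    {x : EuclideanSpace ℂ (Fin n)} (hx : x ∈ quadLattice d B) : quadXi d • x ∈ quadLattice d B :=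
  (quadLattice d B).smul_mem (⟨quadXi d, Algebra.subset_adjoin rfl⟩ : quadRing d) hx

/-- This inclusion alone suffices: passing to a subset can only raise the first minimum, so it is
not necessary to know that 1, ξ span ℤ[ξ] over ℤ. -/
theorem complexIsometry_symm_mem_quadLattice {d : ℤ} (hz : (quadXi d).im ≠ 0) {n : ℕ}
    (B : Matrix (Fin n) (Fin n) ℂ) (hB : LinearIndependent ℂ (basisVec B))
    {x : EuclideanSpace ℝ (Fin (2 * n))}
    (hx : x ∈ Submodule.span ℤ (Set.range (realLatticeBasis hz B hB))) :
    (complexIsometry n).symm x ∈ quadLattice d B := by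
  induction hx using Submodule.span_induction with
  | mem x h =>
    obtain ⟨⟨j, s⟩, rfl⟩ := h
    have hj := basisVec_mem_quadLattice d B j
    fin_cases s
    · simpa [realLatticeBasis, Basis.smulTower'_apply, columnBasis_apply, basisOneOfImNeZero]
        using hj
    · simpa [realLatticeBasis, Basis.smulTower'_apply, columnBasis_apply, basisOneOfImNeZero]
        using quadXi_smul_mem_quadLattice d B hj
  | zero => simp
  | add x y _ _ hx hy => simpa using add_mem hx hy
  | smul a x _ hx => simpa using zsmul_mem hx a

theorem successiveMin_one_quadLattice_sq_le {d : ℤ} (hd : 0 < d) {n : ℕ} (hn : 0 < n)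
    (B : Matrix (Fin n) (Fin n) ℂ) (hB : LinearIndependent ℂ (basisVec B)) :
    successiveMin (quadRing d) (quadLattice d B) 1 ^ 2 ≤
      hermiteConstant (2 * n) * |(quadPhi d).det| * ‖B.det‖ ^ (2 / (n : ℝ)) := by
  have hz : (quadXi d).im ≠ 0 := (quadXi_im_pos hd).ne'
  have := isTorsionFree_quadRing d n
  have : IsTorsionFree ℤ (EuclideanSpace ℝ (Fin (2 * n))) := .trans_faithfulSMul ℤ ℝ _
  set L := Submodule.span ℤ (Set.range (realLatticeBasis hz B hB)) with hL
  have hle : successiveMin (quadRing d) (quadLattice d B) 1 ≤ successiveMin ℤ L 1 := by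
    refine le_successiveMin_one L ?_ fun x hx hx0 => ?_
    · exact (Submodule.ne_bot_iff _).2 ⟨_, Submodule.subset_span ⟨(⟨0, hn⟩, 0), rfl⟩,
        (realLatticeBasis hz B hB).ne_zero _⟩
    · rw [← (complexIsometry n).symm.norm_map x]
      exact successiveMin_one_le _ (complexIsometry_symm_mem_quadLattice hz B hB hx) (by simpa)
  have hn' : (n : ℝ) ≠ 0 := by exact_mod_cast hn.ne'
  calc _ ≤ successiveMin ℤ L 1 ^ 2 := pow_le_pow_left₀ (successiveMin_nonneg _ one_pos) hle 2
    _ ≤ _ := successiveMin_sq_le_hermiteConstant (by omega) L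
    _ = _ := by
      rw [hL, covolume_span_realLatticeBasis, quadPhi_det, mul_assoc,
        show (2 : ℝ) / ((2 * n : ℕ) : ℝ) = (n : ℝ)⁻¹ by push_cast; field_simp,
        Real.mul_rpow (by positivity) (by positivity), Real.pow_rpow_inv_natCast (abs_nonneg _) hn.ne',
        ← Real.rpow_natCast, ← Real.rpow_mul (norm_nonneg _), Nat.cast_ofNat, ← div_eq_mul_inv]

/-! ### Rescaling by the successive minima -/

/-- The complex span of the lattice vectors shorter than the `k`-th successive minimum. -/
noncomputable def shortSpan (d : ℤ) {n : ℕ} (B : Matrix (Fin n) (Fin n) ℂ) (k : ℕ) :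
    Submodule ℂ (EuclideanSpace ℂ (Fin n)) :=
  Submodule.span ℂ {x | x ∈ quadLattice d B ∧
    ‖x‖ < successiveMin (quadRing d) (quadLattice d B) k}

theorem finrank_shortSpan_lt (d : ℤ) {n : ℕ} (B : Matrix (Fin n) (Fin n) ℂ) {k : ℕ} (hk : 0 < k) :
    finrank ℂ (shortSpan d B k) < k := by
  by_contra! h
  obtain ⟨f, hfS, -, hf⟩ := Submodule.exists_fun_fin_finrank_span_eq ℂ
    {x | x ∈ quadLattice d B ∧ ‖x‖ < successiveMin (quadRing d) (quadLattice d B) k}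
  have : Nonempty (Fin k) := ⟨⟨0, hk⟩⟩
  let v : Fin k → EuclideanSpace ℂ (Fin n) := f ∘ Fin.castLE h
  have hv : LinearIndependent (quadRing d) v :=
    (hf.comp _ (Fin.castLE_injective h)).restrict_scalars' (quadRing d)
  -- The longest of the k vectors is still strictly shorter than the k-th minimum, yet its length
  -- bounds them all. Attainment of the infimum is never needed.
  obtain ⟨i, hi⟩ := Finite.exists_max fun i => ‖v i‖
  exact (hfS (Fin.castLE h i)).2.not_ge
    (successiveMin_le _ hk v hv fun j => ⟨(hfS (Fin.castLE h j)).1, hi j⟩)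

theorem successiveMin_quadLattice_mono (d : ℤ) {n : ℕ} (B : Matrix (Fin n) (Fin n) ℂ)
    (hB : LinearIndependent ℂ (basisVec B)) {i j : ℕ} (hi : 0 < i) (hij : i ≤ j) (hj : j ≤ n) :
    successiveMin (quadRing d) (quadLattice d B) i ≤
      successiveMin (quadRing d) (quadLattice d B) j := by
  refine le_csInf ?_ ?_
  -- The set defining the j-th minimum must be nonempty: j ≤ n columns of B qualify, with the sum of
  -- all column norms as a crude common bound.
  · refine ⟨∑ k, ‖basisVec B k‖, basisVec B ∘ Fin.castLE hj,
      (hB.comp _ (Fin.castLE_injective hj)).restrict_scalars' (quadRing d), fun k =>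
        ⟨basisVec_mem_quadLattice d B _, ?_⟩⟩
    exact Finset.single_le_sum (f := fun k => ‖basisVec B k‖) (fun _ _ => norm_nonneg _)
      (Finset.mem_univ _)
  · rintro r ⟨v, hv, hvL⟩
    exact successiveMin_le _ hi (v ∘ Fin.castLE hij) (hv.comp _ (Fin.castLE_injective hij))
      fun k => hvL _

theorem basisVec_toMatrix_mul {n : ℕ}
    (T : EuclideanSpace ℂ (Fin n) →ₗ[ℂ] EuclideanSpace ℂ (Fin n))
    (B : Matrix (Fin n) (Fin n) ℂ) (j : Fin n) :
    basisVec (LinearMap.toMatrix (EuclideanSpace.basisFun (Fin n) ℂ).toBasis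
      (EuclideanSpace.basisFun (Fin n) ℂ).toBasis T * B) j = T (basisVec B j) := by
  rw [← toLin_basisFun_apply, Matrix.toLin_mul _ (EuclideanSpace.basisFun (Fin n) ℂ).toBasis,
    LinearMap.comp_apply, toLin_basisFun_apply, Matrix.toLin_toMatrix]

theorem exists_mem_quadLattice_of_mem_quadLattice_toMatrix_mul (d : ℤ) {n : ℕ}
    (T : EuclideanSpace ℂ (Fin n) →ₗ[ℂ] EuclideanSpace ℂ (Fin n))
    (B : Matrix (Fin n) (Fin n) ℂ) {y : EuclideanSpace ℂ (Fin n)}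
    (hy : y ∈ quadLattice d (LinearMap.toMatrix (EuclideanSpace.basisFun (Fin n) ℂ).toBasis
      (EuclideanSpace.basisFun (Fin n) ℂ).toBasis T * B)) :
    ∃ x ∈ quadLattice d B, T x = y := by
  have h : quadLattice d (LinearMap.toMatrix (EuclideanSpace.basisFun (Fin n) ℂ).toBasis
      (EuclideanSpace.basisFun (Fin n) ℂ).toBasis T * B) ≤
      (quadLattice d B).map (T.restrictScalars (quadRing d)) := by
    refine Submodule.span_le.2 ?_
    rintro _ ⟨j, rfl⟩
    exact ⟨_, basisVec_mem_quadLattice d B j, (basisVec_toMatrix_mul T B j).symm⟩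
  exact h hy

theorem one_le_norm_toLin_diagonal {d : ℤ} {n : ℕ} (B : Matrix (Fin n) (Fin n) ℂ)
    (hB : LinearIndependent ℂ (basisVec B))
    (hpos : ∀ k : Fin n, 0 < successiveMin (quadRing d) (quadLattice d B) (k + 1))
    (e : OrthonormalBasis (Fin n) ℂ (EuclideanSpace ℂ (Fin n)))
    (he : ∀ k : Fin n, e k ∈ (shortSpan d B (k + 1))ᗮ)
    {x : EuclideanSpace ℂ (Fin n)} (hx : x ∈ quadLattice d B) (hx0 : x ≠ 0) :
    1 ≤ ‖Matrix.toLin e.toBasis e.toBasis (Matrix.diagonal fun k : Fin n =>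
      ((successiveMin (quadRing d) (quadLattice d B) (k + 1))⁻¹ : ℂ)) x‖ := by
  set l : Fin n → ℝ := fun k => successiveMin (quadRing d) (quadLattice d B) (k + 1) with hl
  have hmono : Monotone l := fun i j hij =>
    successiveMin_quadLattice_mono d B hB (by omega) (by simpa using hij) (by omega)
  set y := Matrix.toLin e.toBasis e.toBasis (Matrix.diagonal fun k : Fin n => ((l k)⁻¹ : ℂ)) x
    with hy
  have hyr (k : Fin n) : e.repr y k = (l k : ℂ)⁻¹ * e.repr x k := by
    have := congrFun (LinearMap.toMatrix_mulVec_repr e.toBasis e.toBasis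
      (Matrix.toLin e.toBasis e.toBasis (Matrix.diagonal fun k : Fin n => ((l k)⁻¹ : ℂ))) x) k
    rw [LinearMap.toMatrix_toLin, Matrix.mulVec_diagonal] at this
    simpa [hy] using this.symm
  have hs : (Finset.univ.filter fun k => e.repr x k ≠ 0).Nonempty := by
    by_contra h
    rw [Finset.not_nonempty_iff_eq_empty, Finset.filter_eq_empty_iff] at h
    refine hx0 (e.repr.map_eq_zero_iff.1 ?_)
    ext k
    simpa using h (Finset.mem_univ k)
  -- k is the last nonzero coordinate of x. If ‖x‖ < l k, then x lies in the short span orthogonal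
  -- to `e k`, so its k-th coordinate vanishes.
  obtain ⟨k, hk, hkmax⟩ := Finset.exists_max_image _ id hs
  replace hk : e.repr x k ≠ 0 := (Finset.mem_filter.1 hk).2
  have hlk : l k ≤ ‖x‖ := by
    by_contra! h
    refine hk ?_
    rw [e.repr_apply_apply]
    exact (Submodule.mem_orthogonal' _ _).1 (he k) x (Submodule.subset_span ⟨hx, h⟩)
  -- Only coordinates i ≤ k survive, and there l i ≤ l k by monotonicity.
  have hterm (i : Fin n) : ‖e.repr x i‖ ^ 2 ≤ l k ^ 2 * ‖e.repr y i‖ ^ 2 := by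
    by_cases hi : e.repr x i = 0
    · rw [hi, norm_zero, zero_pow two_ne_zero]; positivity
    · have hik : i ≤ k := hkmax i (by simpa using hi)
      have hli : 0 < l i := hpos i
      rw [hyr, ← mul_pow]
      refine pow_le_pow_left₀ (norm_nonneg _) ?_ 2
      rw [norm_mul, norm_inv, Complex.norm_real, Real.norm_of_nonneg hli.le, ← mul_assoc,
        ← div_eq_mul_inv]
      exact le_mul_of_one_le_left (norm_nonneg _) ((one_le_div hli).2 (hmono hik))
  have hsum : ‖x‖ ^ 2 ≤ l k ^ 2 * ‖y‖ ^ 2 := by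
    rw [← e.repr.norm_map x, ← e.repr.norm_map y, EuclideanSpace.norm_sq_eq,
      EuclideanSpace.norm_sq_eq, Finset.mul_sum]
    exact Finset.sum_le_sum fun i _ => hterm i
  have hlk0 : 0 < l k := hpos k
  rw [← mul_pow, sq_le_sq₀ (norm_nonneg _) (by positivity)] at hsum
  exact le_of_mul_le_mul_left (by simpa using hlk.trans hsum) hlk0

theorem prod_successiveMin_quadLattice_sq_le {d : ℤ} (hd : 0 < d) {n : ℕ} (hn : 0 < n)
    (B : Matrix (Fin n) (Fin n) ℂ) (hB : LinearIndependent ℂ (basisVec B)) :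
    ∏ k : Fin n, successiveMin (quadRing d) (quadLattice d B) (k + 1) ^ 2 ≤
      hermiteConstant (2 * n) ^ n * |(quadPhi d).det| ^ n * ‖B.det‖ ^ 2 := by
  have hγ := hermiteConstant_nonneg (2 * n)
  have htf := isTorsionFree_quadRing d n
  -- A vanishing minimum makes the product 0, so positivity of the minima need not be derived from
  -- discreteness of Λ.
  by_cases h0 : ∃ k : Fin n, successiveMin (quadRing d) (quadLattice d B) (k + 1) = 0
  · obtain ⟨k, hk⟩ := h0
    rw [Finset.prod_eq_zero (Finset.mem_univ k) (by rw [hk]; norm_num)]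
    positivity
  push Not at h0
  set l : Fin n → ℝ := fun k => successiveMin (quadRing d) (quadLattice d B) (k + 1) with hl
  have hpos (k : Fin n) : 0 < l k :=
    (successiveMin_nonneg _ k.succ_pos).lt_of_ne' (h0 k)
  obtain ⟨e, he⟩ := exists_orthonormalBasis_mem_orthogonal (𝕜 := ℂ)
    (finrank_euclideanSpace_fin (𝕜 := ℂ) (n := n)) (fun k => shortSpan d B (k + 1))
    fun k _ => Nat.lt_succ_iff.1 (finrank_shortSpan_lt d B k.succ_pos)
  set T := Matrix.toLin e.toBasis e.toBasis (Matrix.diagonal fun k : Fin n => ((l k)⁻¹ : ℂ))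
    with hT
  have hdetT : LinearMap.det T = ∏ k, (l k : ℂ)⁻¹ := by
    rw [hT, LinearMap.det_toLin, Matrix.det_diagonal]
  have hdetT0 : LinearMap.det T ≠ 0 := by
    rw [hdetT]
    exact Finset.prod_ne_zero_iff.2 fun k _ => inv_ne_zero (by exact_mod_cast (hpos k).ne')
  -- T is ℂ-linear, so TΛ is again a ℤ[ξ]-lattice, with the columns of A as basis, and the first
  -- inequality applies to it.
  set A := LinearMap.toMatrix (EuclideanSpace.basisFun (Fin n) ℂ).toBasis
    (EuclideanSpace.basisFun (Fin n) ℂ).toBasis T * B with hA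
  have hdetA : ‖A.det‖ = (∏ k, l k)⁻¹ * ‖B.det‖ := by
    rw [hA, Matrix.det_mul, LinearMap.det_toMatrix, hdetT, norm_mul, norm_prod,
      ← Finset.prod_inv_distrib]
    congr 1
    refine Finset.prod_congr rfl fun k _ => ?_
    rw [norm_inv, Complex.norm_real, Real.norm_of_nonneg (hpos k).le]
  have hAind : LinearIndependent ℂ (basisVec A) := by
    have : basisVec A = T ∘ basisVec B := funext (basisVec_toMatrix_mul T B)
    rw [this]
    exact hB.map' T (LinearMap.equivOfDetNeZero T hdetT0).ker
  have hone : 1 ≤ successiveMin (quadRing d) (quadLattice d A) 1 := by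
    refine le_successiveMin_one _ ?_ fun y hy hy0 => ?_
    · exact (Submodule.ne_bot_iff _).2 ⟨_, basisVec_mem_quadLattice d A ⟨0, hn⟩, hAind.ne_zero _⟩
    · obtain ⟨x, hx, rfl⟩ := exists_mem_quadLattice_of_mem_quadLattice_toMatrix_mul d T B hy
      exact one_le_norm_toLin_diagonal B hB hpos e he hx (by rintro rfl; simp at hy0)
  have key := (one_le_pow₀ hone (n := 2)).trans (successiveMin_one_quadLattice_sq_le hd hn A hAind)
  replace key := one_le_pow₀ key (n := n)
  have hn' : (n : ℝ) ≠ 0 := by exact_mod_cast hn.ne'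
  rw [mul_pow, mul_pow, ← Real.rpow_natCast (_ ^ _), ← Real.rpow_mul (norm_nonneg _),
    div_mul_cancel₀ _ hn', Real.rpow_ofNat, hdetA, mul_pow, inv_pow, mul_left_comm,
    ← div_eq_inv_mul] at key
  rw [Finset.prod_pow]
  exact (one_le_div (pow_pos (Finset.prod_pos fun k _ => hpos k) 2)).1 key

theorem mainTheorem6 (d : ℤ) (hd : 0 < d) (hsq : Squarefree d) (n : ℕ) (hn : 0 < n)
    (B : Matrix (Fin n) (Fin n) ℂ) (hB : LinearIndependent ℂ (basisVec B)) :
    successiveMin (quadRing d) (quadLattice d B) 1 ^ 2 ≤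
        hermiteConstant (2 * n) * |(quadPhi d).det| * ‖B.det‖ ^ (2 / (n : ℝ)) ∧
      ∏ j ∈ Finset.Icc 1 n, successiveMin (quadRing d) (quadLattice d B) j ^ 2 ≤
        hermiteConstant (2 * n) ^ n * |(quadPhi d).det| ^ n * ‖B.det‖ ^ 2 := by
  refine ⟨successiveMin_one_quadLattice_sq_le hd hn B hB, ?_⟩
  have h := prod_successiveMin_quadLattice_sq_le hd hn B hB
  rw [Fin.prod_univ_eq_prod_range
    (fun k => successiveMin (quadRing d) (quadLattice d B) (k + 1) ^ 2)] at h
  rwa [← Finset.Ico_add_one_right_eq_Icc, Finset.prod_Ico_eq_prod_range, Nat.add_sub_cancel,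
    Finset.prod_congr rfl fun k _ => by rw [add_comm 1 k]]
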